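/- An \emph{effect algebra} $(E;\oplus,0,1)$ is a set with elements $0\neq 1$ and a partial binary operation $\oplus$ which is commutative and associative (if one side of the law is defined, so is the other, and they agree), such that for every $a$ there is a unique $a'$ with $a\oplus a'=1$, and $1\oplus a$ is defined only for $a=0$. It is ordered by $a\le b$ iff $a\oplus c=b$ for some $c$, and is a \emph{lattice effect algebra} if this order is a lattice. Write $nx=x\oplus\cdots\oplus x$ ($n$ times) when defined. For $x\ne 0$ let $\operatorname{ord}(x)$ be the greatest $n$ such that $nx$ is defined, or $\infty$ if there is none. $E$ is \emph{Archimedean} if $\operatorname{ord}(x)<\infty$ for all $x\neq 0$, and \emph{atomic} if every nonzero element is above an atom (a minimal nonzero element). Let $\tau_i$ be the interval topology (the intervals $[a,b]$, $a\le b$, form a closed subbasis). A net $(x_\alpha)$ order converges to $x$ if there are nets $u_\alpha\le x_\alpha\le v_\alpha$ over the same directed set, $(u_\alpha)$ increasing with $\bigvee u_\alpha=x$ and $(v_\alpha)$ decreasing with $\bigwedge v_\alpha=x$. Let $\tau_o$ be the order topology, the finest topology in which every order convergent net converges to its order limits. $E$ is \emph{(o)-continuous} if, for every increasing net $(x_\alpha)$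 with $\bigvee x_\alpha=x$ and every $y\in E$, $\bigvee(x_\alpha\wedge y)=x\wedge y$. $E$ is \emph{almost orthogonal} if for every atom $a$ only finitely many atoms $b$ satisfy $b\not\le a'$. Let $\mathcal U$ be the set of all joins $\bigvee_{i=1}^n l_ia_i$ with $n\ge1$, $a_i$ atoms of $E$ and $1\le l_i\le\operatorname{ord}(a_i)$, and let $\mathcal V=\{x\in E: x'\in\mathcal U\}$. For $u\in\mathcal U$ and $v\in\mathcal V$ let $f_u,g_v:E\to\{0,1\}$ be given by $f_u(x)=1$ iff $u\le x$, and $g_v(x)=1$ iff $x\le v$. Let $\tau_\Phi$ be the topology of the uniformity on $E$ induced by the pseudometrics $(a,b)\mapsto|\varphi(a)-\varphi(b)|$, $\varphi\in\Phi=\{f_u:u\in\mathcal U\}\cup\{g_v:v\in\mathcal V\}$. \textbf{Theorem.} Let $E$ be an Archimedean atomic lattice effect algebra. The following conditions are equivalent: (i) $\tau_i=\tau_o=\tau_\Phi$; (ii) $E$ is (o)-continuous and $\tau_i$ is Hausdorff; (iii) $E$ is almost orthogonal. -/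

import Mathlib

open Set Filter

universe u

/-- An effect algebra `(E; ⊕, 0, 1)`. The partial operation `⊕` is `oplus`, where
`oplus a b = none` means that `a ⊕ b` is not defined. -/
class EffectAlgebra (E : Type u) extends Zero E, One E where
  /-- The partial sum. -/
  oplus : E → E → Option E
  zero_ne_one' : (0 : E) ≠ 1
  oplus_comm : ∀ a b : E, oplus a b = oplus b a
  /-- `(a ⊕ b) ⊕ c = a ⊕ (b ⊕ c)`: one side is defined iff the other one is, and then they agree. -/
  oplus_assoc : ∀ a b c : E,
    ((oplus a b).bind fun d => oplus d c) = ((oplus b c).bind fun d => oplus a d)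
  existsUnique_compl : ∀ a : E, ∃! b : E, oplus a b = some 1
  eq_zero_of_one_oplus : ∀ a : E, (oplus 1 a).isSome → a = 0

/-- A lattice effect algebra: an effect algebra whose derived order
(`a ≤ b` iff `a ⊕ c = b` for some `c`) is a lattice order. -/
class LatticeEffectAlgebra (E : Type u) extends EffectAlgebra E, Lattice E where
  le_iff_exists_oplus : ∀ a b : E, a ≤ b ↔ ∃ c : E, oplus a c = some b

namespace EffectAlgebra

section Basic

variable {E : Type u} [EffectAlgebra E]

/-- The element `a'`, the unique `b` with `a ⊕ b = 1`. -/
noncomputable def compl (a : E) : E := (existsUnique_compl a).choose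

theorem oplus_compl (a : E) : oplus a (compl a) = some 1 :=
  (existsUnique_compl a).choose_spec.1

theorem eq_compl_of_oplus {a b : E} (h : oplus a b = some 1) : b = compl a :=
  (existsUnique_compl a).choose_spec.2 b h

theorem compl_compl (a : E) : compl (compl a) = a :=
  (eq_compl_of_oplus (by rw [oplus_comm]; exact oplus_compl a)).symm

theorem oplus_zero (a : E) : oplus a 0 = some a := by
  have h1 : compl (1 : E) = 0 := eq_zero_of_one_oplus _ (by rw [oplus_compl]; rfl)
  have h2 : oplus (1 : E) 0 = some 1 := by
    have := oplus_compl (1 : E)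
    rwa [h1] at this
  have h3 := oplus_assoc (compl a) a 0
  rw [oplus_comm (compl a) a, oplus_compl, Option.bind_some, h2] at h3
  cases h : oplus a 0 with
  | none => rw [h] at h3; simp at h3
  | some d =>
    rw [h, Option.bind_some] at h3
    rw [eq_compl_of_oplus h3.symm, compl_compl]

/-- The multiple `n x = x ⊕ ⋯ ⊕ x` (`n` times), if it is defined. -/
def multiple (x : E) : ℕ → Option E
  | 0 => some 0
  | n + 1 => (multiple x n).bind fun y => oplus y x

theorem multiple_one (x : E) : multiple x 1 = some x := by
  simp [multiple, oplus_comm 0 x, oplus_zero]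

/-- The order `ord(x)`: the greatest `n` such that `n x` is defined, and `∞` if all are. -/
noncomputable def ord (x : E) : ℕ∞ :=
  sSup {m : ℕ∞ | ∃ n : ℕ, m = n ∧ (multiple x n).isSome}

variable (E) in
/-- `E` is Archimedean: every nonzero element has a finite order (all multiples of `0` exist). -/
def IsArchimedean : Prop := ∀ x : E, x ≠ 0 → ord x < ⊤

end Basic

/-- `0` and `1` are the least and the greatest element, so that Mathlib's `IsAtom` and
`IsAtomic` can be used. -/
instance {E : Type u} [LatticeEffectAlgebra E] : BoundedOrder E where
  bot := 0
  bot_le a := (LatticeEffectAlgebra.le_iff_exists_oplus 0 a).2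
    ⟨a, by rw [oplus_comm, oplus_zero]⟩
  top := 1
  le_top a := (LatticeEffectAlgebra.le_iff_exists_oplus a 1).2 ⟨_, oplus_compl a⟩

section Topologies

/-- The interval topology: the intervals `[a, b]`, `a ≤ b`, form a closed subbasis. -/
@[reducible] def intervalTopology (L : Type u) [Lattice L] : TopologicalSpace L :=
  TopologicalSpace.generateFrom {s | ∃ a b : L, a ≤ b ∧ s = (Icc a b)ᶜ}

/-- The net `x` order converges to `l`: there are nets `v ↑ l` and `w ↓ l` with `v ≤ x ≤ w`. -/
def OrderConverges {L : Type u} [PartialOrder L] {ι : Type u} [Preorder ι]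
    (x : ι → L) (l : L) : Prop :=
  ∃ v w : ι → L, Monotone v ∧ IsLUB (range v) l ∧ Antitone w ∧ IsGLB (range w) l ∧
    ∀ i, v i ≤ x i ∧ x i ≤ w i

/-- In the topology `t`, every order convergent net converges to its order limits. Index sets in
the universe of `L` are enough: a net with bounding nets `v`, `w` can be replaced by the net of
the triples `(x i, v i, w i)`, directed by the last two coordinates. -/
def OrderConvergenceImpliesConvergence {L : Type u} [PartialOrder L]
    (t : TopologicalSpace L) : Prop :=
  ∀ (ι : Type u) [Preorder ι] [IsDirectedOrder ι] [Nonempty ι] (x : ι → L) (l : L),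
    OrderConverges x l → Tendsto x atTop (@nhds L t l)

/-- The order topology: the finest topology in which order convergence implies convergence.
In Mathlib's order on topologies, finer means smaller. -/
@[reducible] def orderTopology (L : Type u) [PartialOrder L] : TopologicalSpace L :=
  sInf {t | OrderConvergenceImpliesConvergence t}

/-- The infimum in the definition of `orderTopology` is attained. -/
theorem orderTopology_isLeast (L : Type u) [PartialOrder L] :
    IsLeast {t : TopologicalSpace L | OrderConvergenceImpliesConvergence t}
      (orderTopology L) := by
  refine ⟨?_, fun t ht => sInf_le ht⟩
  intro ι _ _ _ x l h
  rw [orderTopology, nhds_sInf]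
  simp only [tendsto_iInf]
  exact fun t ht => ht ι x l h

/-- A lattice is (o)-continuous if `x_α ↑ x` implies `x_α ∧ y ↑ x ∧ y` for all `y`. -/
def OContinuous (L : Type u) [Lattice L] : Prop :=
  ∀ (ι : Type u) [Preorder ι] [IsDirectedOrder ι] [Nonempty ι] (x : ι → L) (l y : L),
    Monotone x → IsLUB (range x) l → IsLUB (range fun i => x i ⊓ y) (l ⊓ y)

end Topologies

section Atomic

variable (E : Type u) [LatticeEffectAlgebra E]

/-- `E` is almost orthogonal: for every atom `a`, only finitely many atoms `b` have `b ≰ a'`. -/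
def AlmostOrthogonal : Prop :=
  ∀ a : E, IsAtom a → {b : E | IsAtom b ∧ ¬ b ≤ compl a}.Finite

/-- The set `𝒰` of all joins `⋁_{i < n} l_i a_i`, `n ≥ 1`, with atoms `a_i` and existing multiples
`y_i = l_i a_i`, `l_i ≥ 1` (that is, `1 ≤ l_i ≤ ord(a_i)`). -/
def finiteJoins : Set E :=
  {x | ∃ (n : ℕ) (a y : Fin n → E) (l : Fin n → ℕ), 1 ≤ n ∧
    (∀ i, IsAtom (a i) ∧ 1 ≤ l i ∧ multiple (a i) (l i) = some (y i)) ∧ IsLUB (range y) x}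

/-- The set `𝒱` of all `x` with `x' ∈ 𝒰`. -/
def cofiniteMeets : Set E := {x | compl x ∈ finiteJoins E}

variable {E}

open Classical in
/-- The function `f_u`, with value `1` at `x` if `u ≤ x` and `0` otherwise. -/
noncomputable def fFun (w x : E) : ℝ := if w ≤ x then 1 else 0

open Classical in
/-- The function `g_v`, with value `1` at `x` if `x ≤ v` and `0` otherwise. -/
noncomputable def gFun (v x : E) : ℝ := if x ≤ v then 1 else 0

variable (E)

/-- The function family `Φ = {f_u | u ∈ 𝒰} ∪ {g_v | v ∈ 𝒱}`. -/
def phiFamily : Set (E → ℝ) := fFun '' finiteJoins E ∪ gFun '' cofiniteMeets E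

/-- The uniformity induced by the pseudometrics `(a, b) ↦ |φ a - φ b|`, `φ ∈ Φ`. -/
@[reducible] noncomputable def phiUniformity : UniformSpace E :=
  ⨅ φ ∈ phiFamily E, (PseudoMetricSpace.induced φ inferInstance).toUniformSpace

/-- The topology `τ_Φ` of the uniformity induced by `Φ`. -/
@[reducible] noncomputable def phiTopology : TopologicalSpace E := (phiUniformity E).toTopologicalSpace

end Atomic

end EffectAlgebra

/-!
The multiples `k a` of atoms `a` are join-dense in an Archimedean atomic lattice effect algebra
(`isLUB_atomMultiples`): if `z < x` lies above all `k a ≤ x`, pick an atom `a ≤ x ⊖ z` and the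
largest `k` with `k a ≤ x`; then `(k + 1) a ≤ z ⊕ a ≤ x`, a contradiction. Dually, the elements
`(k a)'` are meet-dense. The half-lines `[k a, 1]` and `[0, (k a)']` are clopen in `τ_Φ`, so the
order intervals around `x` that are open in `τ_Φ` shrink to `x` in order, whence `τ_Φ` is finer than
`τ_o` (`le_orderTopology`). As `τ_o` is always finer than `τ_i` (`orderTopology_le_intervalTopology`),
condition (i) just says that all half-lines `[u, 1]`, `u ∈ 𝒰`, and `[0, v]`, `v ∈ 𝒱`, are
`τ_i`-clopen.

* (i) ⇒ (ii): clopen half-lines `[k a, 1]` separate points, and an increasing net with supremum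
  above `k a` eventually enters `[k a, 1]`; this gives (o)-continuity (`oContinuous_of_isOpen_Ici`).
* (ii) ⇒ (iii): if infinitely many atoms `b` had `b ≰ a'`, take a nonprincipal ultrafilter on them
  and the filter `G` of all `d` with `b ≤ d` for almost all `b`. Since `τ_i` is Hausdorff,
  `⋀ G = 0` (`isGLB_eventually_le`), so `⋁ {d' ∧ a | d ∈ G} = a` by (o)-continuity. But `d' ∧ a = 0`
  for every `d ∈ G`, as some `b ≤ d` is not orthogonal to `a`.
* (iii) ⇒ (i): multiples of distinct orthogonal atoms are orthogonal
  (`multiple_le_compl_multiple`), so `y ≰ (l a)'` means that `y` lies above one of the finitely many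
  multiples `k c` of the atoms `c` with `c = a` or `c ≰ a'`. Hence the complement of `[0, (l a)']`
  is a finite union of intervals, and so is the complement of `[l a, 1]`.
-/

namespace EffectAlgebra

open scoped Topology

/-! ### Partial sums and the order -/

section Basic

variable {E : Type u}

theorem zero_oplus [EffectAlgebra E] (a : E) : oplus 0 a = some a := by
  rw [oplus_comm, oplus_zero]

theorem exists_oplus_right [EffectAlgebra E] {a b c d e : E} (h : oplus a b = some d)
    (h' : oplus d c = some e) : ∃ f, oplus b c = some f ∧ oplus a f = some e := by
  have := oplus_assoc a b c
  rw [h, Option.bind_some, h'] at this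
  exact Option.bind_eq_some_iff.1 this.symm

theorem exists_oplus_left [EffectAlgebra E] {a b c d e : E} (h : oplus b c = some d)
    (h' : oplus a d = some e) : ∃ f, oplus a b = some f ∧ oplus f c = some e := by
  have := oplus_assoc a b c
  rw [h, Option.bind_some, h'] at this
  exact Option.bind_eq_some_iff.1 this

theorem oplus_left_cancel [EffectAlgebra E] {a b c d : E} (h : oplus a b = some d)
    (h' : oplus a c = some d) : b = c := by
  have key : ∀ x, oplus a x = some d → ∃ f, oplus (compl d) a = some f ∧ x = compl f := by
    intro x hx
    have h1 : oplus (compl d) d = some 1 := by rw [oplus_comm, oplus_compl]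
    obtain ⟨f, hf, hfx⟩ := exists_oplus_left hx h1
    exact ⟨f, hf, eq_compl_of_oplus hfx⟩
  obtain ⟨f, hf, rfl⟩ := key b h
  obtain ⟨g, hg, rfl⟩ := key c h'
  rw [hf] at hg
  rw [Option.some.inj hg]

variable [LatticeEffectAlgebra E]

theorem le_of_oplus {a b c : E} (h : oplus a b = some c) : a ≤ c :=
  (LatticeEffectAlgebra.le_iff_exists_oplus a c).2 ⟨b, h⟩

theorem le_of_oplus' {a b c : E} (h : oplus a b = some c) : b ≤ c :=
  le_of_oplus (by rw [oplus_comm]; exact h)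

theorem exists_oplus_iff_le_compl {a b : E} : (∃ c, oplus a b = some c) ↔ b ≤ compl a := by
  constructor
  · rintro ⟨c, hc⟩
    obtain ⟨f, hf, hf1⟩ := exists_oplus_right hc (oplus_compl c)
    rw [← eq_compl_of_oplus hf1]
    exact le_of_oplus hf
  · intro h
    obtain ⟨d, hd⟩ := (LatticeEffectAlgebra.le_iff_exists_oplus _ _).1 h
    obtain ⟨f, hf, -⟩ := exists_oplus_left hd (oplus_compl a)
    exact ⟨f, hf⟩

theorem le_compl_comm {a b : E} : a ≤ compl b ↔ b ≤ compl a := by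
  rw [← exists_oplus_iff_le_compl, ← exists_oplus_iff_le_compl, oplus_comm]

theorem compl_le_compl_iff {a b : E} : compl a ≤ compl b ↔ b ≤ a := by
  rw [le_compl_comm, compl_compl]

theorem compl_le_comm {a b : E} : compl a ≤ b ↔ compl b ≤ a := by
  rw [← compl_le_compl_iff, compl_compl]

theorem compl_bot : compl (⊥ : E) = ⊤ :=
  (eq_compl_of_oplus (zero_oplus (1 : E))).symm

theorem oplus_le_oplus {a b c x y : E} (hx : oplus a c = some x) (hy : oplus b c = some y)
    (h : a ≤ b) : x ≤ y := by
  obtain ⟨d, hd⟩ := (LatticeEffectAlgebra.le_iff_exists_oplus _ _).1 h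
  rw [oplus_comm] at hd
  obtain ⟨f, hf, hdf⟩ := exists_oplus_right hd hy
  rw [hx] at hf
  rw [← Option.some.inj hf] at hdf
  exact le_of_oplus' hdf

theorem le_of_oplus_le_oplus {a b c x y : E} (hx : oplus a c = some x)
    (hy : oplus b c = some y) (h : x ≤ y) : a ≤ b := by
  obtain ⟨d, hd⟩ := (LatticeEffectAlgebra.le_iff_exists_oplus _ _).1 h
  rw [oplus_comm] at hx hy
  obtain ⟨f, hf, hcf⟩ := exists_oplus_right hx hd
  rw [oplus_left_cancel hy hcf]
  exact le_of_oplus hf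

/-- The difference `(a ⊕ b) ⊖ (a ∨ b)` is a lower bound of `a` and `b`. -/
theorem oplus_eq_sup_of_disjoint {a b : E} (h : b ≤ compl a) (hd : a ⊓ b = ⊥) :
    oplus a b = some (a ⊔ b) := by
  have key : ∀ {p q r s : E}, oplus p q = some s → oplus (a ⊔ b) r = some s → p ≤ a ⊔ b →
      r ≤ q := by
    intro p q r s hs hr hp
    obtain ⟨t, ht⟩ := (LatticeEffectAlgebra.le_iff_exists_oplus _ _).1 hp
    obtain ⟨f, hf, hpf⟩ := exists_oplus_right ht hr
    rw [oplus_left_cancel hs hpf]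
    exact le_of_oplus' hf
  obtain ⟨s, hs⟩ := exists_oplus_iff_le_compl.2 h
  obtain ⟨r, hr⟩ := (LatticeEffectAlgebra.le_iff_exists_oplus _ _).1
    (sup_le (le_of_oplus hs) (le_of_oplus' hs))
  have hr0 : r = 0 := le_bot_iff.1 <| hd ▸ le_inf
    (key (by rw [oplus_comm]; exact hs) hr le_sup_right) (key hs hr le_sup_left)
  rw [hr0, oplus_zero] at hr
  rw [hs, hr]

/-! ### Multiples of atoms -/

/-- An element disjoint from and orthogonal to `a` is disjoint from and orthogonal to every
multiple of `a`. -/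
theorem multiple_disjoint {a b w : E} {l : ℕ} (h : b ≤ compl a) (hd : a ⊓ b = ⊥)
    (hw : multiple a l = some w) : b ≤ compl w ∧ w ⊓ b = ⊥ := by
  induction l generalizing w with
  | zero =>
    obtain rfl : (0 : E) = w := Option.some.inj hw
    exact ⟨(compl_bot (E := E)).symm ▸ le_top, bot_inf_eq b⟩
  | succ l ih =>
    obtain ⟨v, hv, hvw⟩ := Option.bind_eq_some_iff.1 hw
    obtain ⟨hbv, hvb⟩ := ih hv
    constructor
    · -- `v ⊕ b = v ∨ b` is orthogonal to `a`, because both `v` and `b` are.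
      have h1 : v ⊔ b ≤ compl a :=
        sup_le (le_compl_comm.1 (exists_oplus_iff_le_compl.1 ⟨w, hvw⟩)) h
      obtain ⟨s, hs⟩ := exists_oplus_iff_le_compl.2 h1
      obtain ⟨f, hf, hfs⟩ := exists_oplus_left (oplus_eq_sup_of_disjoint hbv hvb) hs
      rw [oplus_comm, hvw] at hf
      rw [← Option.some.inj hf] at hfs
      exact exists_oplus_iff_le_compl.1 ⟨s, hfs⟩
    · -- For `z = w ∧ b`, the sum `z ⊕ a = z ∨ a` lies below `w = v ⊕ a`, so that `z ≤ v`.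
      have hza : oplus (w ⊓ b) a = some (w ⊓ b ⊔ a) := by
        refine oplus_eq_sup_of_disjoint (le_compl_comm.1 (inf_le_right.trans h)) ?_
        rw [← le_bot_iff, ← hd]
        exact le_inf inf_le_right (inf_le_left.trans inf_le_right)
      have hzv : w ⊓ b ≤ v :=
        le_of_oplus_le_oplus hza hvw (sup_le inf_le_left (le_of_oplus' hvw))
      rw [← le_bot_iff, ← hvb]
      exact le_inf hzv inf_le_right

theorem multiple_le_compl_multiple {a c y w : E} {k l : ℕ} (h : c ≤ compl a) (hd : a ⊓ c = ⊥)
    (hy : multiple a l = some y) (hw : multiple c k = some w) : w ≤ compl y := by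
  obtain ⟨h1, h2⟩ := multiple_disjoint h hd hy
  rw [inf_comm] at h2
  exact le_compl_comm.1 (multiple_disjoint (le_compl_comm.1 h1) h2 hw).1

theorem IsArchimedean.exists_multiple_bound (hE : IsArchimedean E) {x : E} (hx : x ≠ 0) :
    ∃ N : ℕ, ∀ n y, multiple x n = some y → n ≤ N := by
  obtain ⟨N, hN⟩ := ENat.ne_top_iff_exists.1 (hE x hx).ne
  refine ⟨N, fun n y h => ?_⟩
  have h1 : (n : ℕ∞) ≤ ord x := le_sSup ⟨n, rfl, by rw [h]; rfl⟩
  rw [← hN] at h1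
  exact_mod_cast h1

variable (E) in
/-- The existing multiples `l a`, `l ≥ 1`, of atoms `a`. -/
def atomMultiples : Set E := {y | ∃ a, IsAtom a ∧ ∃ l, 1 ≤ l ∧ multiple a l = some y}

theorem atomMultiples_subset_finiteJoins : atomMultiples E ⊆ finiteJoins E := by
  rintro y ⟨a, ha, l, hl, hy⟩
  refine ⟨1, fun _ => a, fun _ => y, fun _ => l, le_rfl, fun _ => ⟨ha, hl, hy⟩, ?_⟩
  rw [range_const]
  exact isLUB_singleton

theorem isLUB_atomMultiples (hE : IsArchimedean E) (hA : IsAtomic E) (x : E) :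
    IsLUB {w | w ∈ atomMultiples E ∧ w ≤ x} x := by
  refine ⟨fun w hw => hw.2, fun z hz => ?_⟩
  by_contra hxz
  obtain ⟨r, hr⟩ := (LatticeEffectAlgebra.le_iff_exists_oplus _ _).1
    (inf_le_right : z ⊓ x ≤ x)
  rcases hA.eq_bot_or_exists_atom_le r with hr0 | ⟨a, ha, har⟩
  · rw [show r = 0 from hr0, oplus_zero] at hr
    exact hxz (inf_eq_right.1 (Option.some.inj hr))
  · obtain ⟨N, hN⟩ := hE.exists_multiple_bound ha.1
    -- All multiples of `a` would exist and lie below `x`.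
    have key : ∀ n, ∃ y, multiple a n = some y ∧ y ≤ x := by
      intro n
      induction n with
      | zero => exact ⟨0, rfl, bot_le⟩
      | succ n ih =>
        obtain ⟨y, hy, hyx⟩ := ih
        have hyz : y ≤ z ⊓ x := by
          rcases Nat.eq_zero_or_pos n with rfl | hn
          · obtain rfl : (0 : E) = y := Option.some.inj hy
            exact bot_le
          · exact le_inf (hz ⟨⟨a, ha, n, hn, hy⟩, hyx⟩) hyx
        obtain ⟨q, hq⟩ := exists_oplus_iff_le_compl.2
          (har.trans (exists_oplus_iff_le_compl.1 ⟨x, hr⟩))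
        obtain ⟨p, hp⟩ := exists_oplus_iff_le_compl.2
          ((exists_oplus_iff_le_compl.1 ⟨q, hq⟩).trans (compl_le_compl_iff.2 hyz))
        refine ⟨p, by rw [multiple, hy, Option.bind_some, hp], ?_⟩
        refine (oplus_le_oplus hp hq hyz).trans ?_
        rw [oplus_comm] at hq hr
        exact oplus_le_oplus hq hr har
    obtain ⟨y, hy, -⟩ := key (N + 1)
    exact absurd (hN _ _ hy) (by omega)

theorem isGLB_compl_atomMultiples (hE : IsArchimedean E) (hA : IsAtomic E) (x : E) :
    IsGLB {v | compl v ∈ atomMultiples E ∧ x ≤ v} x := by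
  refine ⟨fun w hw => hw.2, fun z hz => ?_⟩
  rw [← compl_le_compl_iff]
  refine (isLUB_atomMultiples hE hA (compl x)).2 fun w hw => ?_
  rw [le_compl_comm]
  exact hz ⟨by rw [compl_compl]; exact hw.1, le_compl_comm.1 hw.2⟩

/-- By almost orthogonality, only finitely many multiples `w` of atoms matter for the relation
`y ≰ (l a)'`. -/
theorem exists_finite_le_iff_not_le_compl (hE : IsArchimedean E) (hA : IsAtomic E)
    (hO : AlmostOrthogonal E) {y : E} (hy : y ∈ atomMultiples E) :
    ∃ F : Set E, F.Finite ∧ ∀ x, ¬ x ≤ compl y ↔ ∃ w ∈ F, w ≤ x := by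
  obtain ⟨a, ha, l, hl, hy⟩ := hy
  set B : Set E := {c | IsAtom c ∧ (c = a ∨ ¬ c ≤ compl a)}
  have hBfin : B.Finite := by
    refine ((hO a ha).insert a).subset ?_
    rintro c ⟨hc, rfl | h⟩
    · exact mem_insert _ _
    · exact mem_insert_of_mem _ ⟨hc, h⟩
  have hM : ∀ c : E, IsAtom c → {w | ∃ k, multiple c k = some w}.Finite := by
    intro c hc
    obtain ⟨N, hN⟩ := hE.exists_multiple_bound hc.1
    refine ((finite_Iic N).image fun k => (multiple c k).getD 0).subset ?_
    rintro w ⟨k, hk⟩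
    exact ⟨k, hN k w hk, by simp [hk]⟩
  refine ⟨{w | (∃ c ∈ B, ∃ k, multiple c k = some w) ∧ ¬ w ≤ compl y}, ?_, fun x => ⟨?_, ?_⟩⟩
  · refine (hBfin.biUnion fun c hc => hM c hc.1).subset ?_
    rintro w ⟨⟨c, hc, k, hk⟩, -⟩
    exact mem_biUnion hc ⟨k, hk⟩
  · intro hx
    by_contra! hcon
    refine hx ((isLUB_atomMultiples hE hA x).2 ?_)
    rintro w ⟨⟨c, hc, k, -, hk⟩, hwx⟩
    by_contra hwy
    refine hcon w ⟨⟨c, ⟨hc, ?_⟩, k, hk⟩, hwy⟩ hwx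
    by_contra! hca
    exact hwy (multiple_le_compl_multiple hca.2
      (ha.disjoint_of_ne hc (Ne.symm hca.1)).eq_bot hy hk)
  · rintro ⟨w, ⟨-, hwy⟩, hwx⟩ hxy
    exact hwy (hwx.trans hxy)

end Basic

/-! ### Interval topology and order topology of a lattice -/

section Lattices

variable {L : Type u} [Lattice L]

theorem orderTopology_le_intervalTopology : orderTopology L ≤ intervalTopology L := by
  refine sInf_le fun ι _ _ _ x l hx => ?_
  obtain ⟨v, w, hv, hvl, hw, hwl, hvw⟩ := hx
  refine TopologicalSpace.tendsto_nhds_generateFrom_iff.2 ?_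
  rintro _ ⟨a, b, -, rfl⟩ hl
  rw [mem_compl_iff, mem_Icc, not_and_or] at hl
  rcases hl with hl | hl
  · obtain ⟨i, hi⟩ : ∃ i, ¬ a ≤ w i := by
      by_contra! h
      exact hl (hwl.2 (forall_mem_range.2 h))
    filter_upwards [eventually_ge_atTop i] with j hj hmem
    exact hi (hmem.1.trans ((hvw j).2.trans (hw hj)))
  · obtain ⟨i, hi⟩ : ∃ i, ¬ v i ≤ b := by
      by_contra! h
      exact hl (hvl.2 (forall_mem_range.2 h))
    filter_upwards [eventually_ge_atTop i] with j hj hmem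
    exact hi ((hv hj).trans ((hvw j).1.trans hmem.2))

/-- A topology whose open half-lines `[u, ∞)` and `(-∞, v]` have join-dense and meet-dense end
points is finer than the order topology: every point `x` is the order limit of any net with one
member in each open interval `[u, v]` around `x`. -/
theorem le_orderTopology [BoundedOrder L] {t : TopologicalSpace L}
    (hl : ∀ x : L, IsLUB {w | IsOpen[t] (Ici w) ∧ w ≤ x} x)
    (hu : ∀ x : L, IsGLB {w | IsOpen[t] (Iic w) ∧ x ≤ w} x) : t ≤ orderTopology L := by
  intro U hU
  refine (@isOpen_iff_mem_nhds L t U).2 fun x hx => ?_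
  by_contra hUx
  let S : Set (L × Lᵒᵈ) := {p | (IsOpen[t] (Ici p.1) ∧ p.1 ≤ x) ∧
    IsOpen[t] (Iic (OrderDual.ofDual p.2)) ∧ x ≤ OrderDual.ofDual p.2}
  have hbot : IsOpen[t] (Ici (⊥ : L)) := by rw [Ici_bot]; exact @isOpen_univ L t
  have htop : IsOpen[t] (Iic (⊤ : L)) := by rw [Iic_top]; exact @isOpen_univ L t
  have hchoose : ∀ p : S, ∃ c, (p.1.1 ≤ c ∧ c ≤ OrderDual.ofDual p.1.2) ∧ c ∉ U := by
    intro p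
    by_contra! h
    refine hUx (@mem_of_superset _ _ (Ici p.1.1 ∩ Iic (OrderDual.ofDual p.1.2)) _ ?_ h)
    exact @IsOpen.mem_nhds L t _ _ (@IsOpen.inter L t _ _ p.2.1.1 p.2.2.1) ⟨p.2.1.2, p.2.2.2⟩
  choose c hc hcU using hchoose
  have : Nonempty S := ⟨⟨(⊥, OrderDual.toDual ⊤), ⟨hbot, bot_le⟩, htop, le_top⟩⟩
  have : IsDirectedOrder S := by
    refine ⟨fun p q => ⟨⟨p.1 ⊔ q.1, ⟨?_, sup_le p.2.1.2 q.2.1.2⟩, ?_, ?_⟩, ?_, ?_⟩⟩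
    · have := @IsOpen.inter L t _ _ p.2.1.1 q.2.1.1
      rwa [Ici_inter_Ici] at this
    · have := @IsOpen.inter L t _ _ p.2.2.1 q.2.2.1
      rwa [Iic_inter_Iic] at this
    · exact le_inf p.2.2.2 q.2.2.2
    · exact (le_sup_left : p.1 ≤ p.1 ⊔ q.1)
    · exact (le_sup_right : q.1 ≤ p.1 ⊔ q.1)
  have hconv : OrderConverges c x := by
    refine ⟨fun p => p.1.1, fun p => OrderDual.ofDual p.1.2, fun p q h => h.1, ⟨?_, ?_⟩,
      fun p q h => h.2, ⟨?_, ?_⟩, hc⟩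
    · exact forall_mem_range.2 fun p => p.2.1.2
    · exact fun z hz => (hl x).2 fun w hw =>
        hz ⟨⟨(w, OrderDual.toDual ⊤), hw, htop, le_top⟩, rfl⟩
    · exact forall_mem_range.2 fun p => p.2.2.2
    · exact fun z hz => (hu x).2 fun w hw =>
        hz ⟨⟨(⊥, OrderDual.toDual w), ⟨hbot, bot_le⟩, hw⟩, rfl⟩
  have hev := (orderTopology_isLeast L).1 S c x hconv
    (@IsOpen.mem_nhds L (orderTopology L) x U hU hx)
  obtain ⟨p, hp⟩ := Eventually.exists (p := fun p => c p ∈ U) hev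
  exact hcU p hp

theorem oContinuous_of_isOpen_Ici
    (h : ∀ x : L, IsLUB {w | IsOpen[orderTopology L] (Ici w) ∧ w ≤ x} x) : OContinuous L := by
  intro ι _ _ _ x l y hx hl
  refine ⟨forall_mem_range.2 fun i => inf_le_inf_right _ (hl.1 ⟨i, rfl⟩), fun z hz => ?_⟩
  refine (h (l ⊓ y)).2 fun w hw => ?_
  have hconv : OrderConverges x l :=
    ⟨x, fun _ => l, hx, hl, antitone_const, by rw [range_const]; exact isGLB_singleton,
      fun i => ⟨le_rfl, hl.1 ⟨i, rfl⟩⟩⟩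
  have hev := (orderTopology_isLeast L).1 ι x l hconv
    (@IsOpen.mem_nhds L (orderTopology L) l _ hw.1 (hw.2.trans inf_le_left))
  obtain ⟨i, hi⟩ := Eventually.exists (p := fun i => x i ∈ Ici w) hev
  exact (le_inf hi (hw.2.trans inf_le_right)).trans (hz ⟨i, rfl⟩)

theorem isClosed_Icc_intervalTopology (a b : L) : IsClosed[intervalTopology L] (Icc a b) := by
  by_cases hab : a ≤ b
  · exact (@isOpen_compl_iff L _ (intervalTopology L)).1
      (TopologicalSpace.isOpen_generateFrom_of_mem ⟨a, b, hab, rfl⟩)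
  · rw [Icc_eq_empty hab]
    exact @isClosed_empty L (intervalTopology L)

/-- If the interval topology is Hausdorff, a nonprincipal ultrafilter on the atoms has order
limit superior `⊥`. An interval that belongs to it contains two atoms, so its lower end is `⊥`; hence
the ultrafilter converges to `⊥` in the interval topology. It does not converge to any `e ≠ ⊥`, which
gives an interval `[⊥, d]` that belongs to it and misses `e`. -/
theorem isGLB_eventually_le [BoundedOrder L] (hT : @T2Space L (intervalTopology L))
    (f : Ultrafilter L) (hf : (f : Filter L) ≤ cofinite) (hatom : ∀ᶠ b in (f : Filter L), IsAtom b) :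
    IsGLB {d : L | ∀ᶠ b in (f : Filter L), b ≤ d} ⊥ := by
  have hbot : ∀ c d : L, (∀ᶠ b in (f : Filter L), b ∈ Icc c d) → c = ⊥ := by
    intro c d hcd
    by_contra hc
    obtain ⟨b, ⟨hb, hbne⟩, hba⟩ :=
      ((hcd.and (hf (finite_singleton c).compl_mem_cofinite)).and hatom).exists
    exact hbne ((hba.le_iff_eq hc).1 hb.1).symm
  have hf0 : (f : Filter L) ≤ @nhds L (intervalTopology L) ⊥ := by
    refine TopologicalSpace.tendsto_nhds_generateFrom_iff (f := (f : Filter L)) (m := id).2 ?_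
    rintro _ ⟨c, d, -, rfl⟩ h0
    by_contra hcd
    have hcd' : ∀ᶠ b in (f : Filter L), b ∈ Icc c d := by
      rw [preimage_id] at hcd
      exact Ultrafilter.compl_notMem_iff.1 hcd
    exact h0 ⟨(hbot c d hcd').le, bot_le⟩
  refine ⟨fun _ _ => bot_le, fun e he => ?_⟩
  by_contra hne
  have hfe : ¬ (f : Filter L) ≤ @nhds L (intervalTopology L) e := fun h =>
    hne (@tendsto_nhds_unique L L (intervalTopology L) hT id f e ⊥ _ h hf0).le
  refine hfe (TopologicalSpace.tendsto_nhds_generateFrom_iff (f := (f : Filter L)) (m := id).2 ?_)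
  rintro _ ⟨c, d, -, rfl⟩ hmem
  by_contra hcd
  have hcd' : ∀ᶠ b in (f : Filter L), b ∈ Icc c d := by
    rw [preimage_id] at hcd
    exact Ultrafilter.compl_notMem_iff.1 hcd
  refine hmem ⟨(hbot c d hcd').le.trans bot_le, he ?_⟩
  exact hcd'.mono fun b hb => hb.2

end Lattices

/-! ### The topology of the function family -/

section Phi

variable {E : Type u} [LatticeEffectAlgebra E]

theorem phiTopology_eq_iInf :
    phiTopology E = ⨅ φ ∈ phiFamily E, TopologicalSpace.induced φ inferInstance := by
  simp only [phiTopology, UniformSpace.toTopologicalSpace_iInf]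
  rfl

theorem isClopen_Ici_phiTopology {w : E} (hw : w ∈ finiteJoins E) :
    @IsClopen E (phiTopology E) (Ici w) := by
  have hc : @Continuous E ℝ (phiTopology E) _ (fFun w) := by
    rw [continuous_iff_le_induced, phiTopology_eq_iInf]
    exact iInf₂_le (fFun w) (mem_union_left _ (mem_image_of_mem _ hw))
  have h1 : Ici w = fFun w ⁻¹' Ioi (1 / 2) := by
    ext x; by_cases h : w ≤ x <;> simp [fFun, h]; norm_num
  have h2 : Ici w = fFun w ⁻¹' Ici (1 / 2) := by
    ext x; by_cases h : w ≤ x <;> simp [fFun, h]; norm_num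
  refine ⟨?_, ?_⟩
  · rw [h2]
    exact @IsClosed.preimage E ℝ (phiTopology E) _ _ hc _ isClosed_Ici
  · rw [h1]
    exact @IsOpen.preimage E ℝ (phiTopology E) _ _ hc _ isOpen_Ioi

theorem isOpen_Iic_phiTopology {v : E} (hv : v ∈ cofiniteMeets E) :
    IsOpen[phiTopology E] (Iic v) := by
  have hc : @Continuous E ℝ (phiTopology E) _ (gFun v) := by
    rw [continuous_iff_le_induced, phiTopology_eq_iInf]
    exact iInf₂_le (gFun v) (mem_union_right _ (mem_image_of_mem _ hv))
  have h1 : Iic v = gFun v ⁻¹' Ioi (1 / 2) := by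
    ext x; by_cases h : x ≤ v <;> simp [gFun, h]; norm_num
  rw [h1]
  exact @IsOpen.preimage E ℝ (phiTopology E) _ _ hc _ isOpen_Ioi

theorem le_phiTopology {t : TopologicalSpace E} (hf : ∀ w ∈ finiteJoins E, @IsClopen E t (Ici w))
    (hg : ∀ v ∈ cofiniteMeets E, @IsClopen E t (Iic v)) : t ≤ phiTopology E := by
  rw [phiTopology_eq_iInf]
  refine le_iInf₂ fun φ hφ => continuous_iff_le_induced.1 ?_
  rcases hφ with ⟨w, hw, rfl⟩ | ⟨v, hv, rfl⟩
  · classical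
    exact continuous_const.if (fun a ha => by
      rw [show frontier {x | w ≤ x} = ∅ from (hf w hw).frontier_eq] at ha
      exact absurd ha (notMem_empty a)) continuous_const
  · classical
    exact continuous_const.if (fun a ha => by
      rw [show frontier {x | x ≤ v} = ∅ from (hg v hv).frontier_eq] at ha
      exact absurd ha (notMem_empty a)) continuous_const

theorem phiTopology_le_orderTopology (hE : IsArchimedean E) (hA : IsAtomic E) :
    phiTopology E ≤ orderTopology E := by
  refine le_orderTopology (fun x => ⟨fun w hw => hw.2, fun z hz => ?_⟩)
    (fun x => ⟨fun w hw => hw.2, fun z hz => ?_⟩)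
  · exact (isLUB_atomMultiples hE hA x).2 fun w hw =>
      hz ⟨(isClopen_Ici_phiTopology (atomMultiples_subset_finiteJoins hw.1)).2, hw.2⟩
  · exact (isGLB_compl_atomMultiples hE hA x).2 fun w hw =>
      hz ⟨isOpen_Iic_phiTopology (atomMultiples_subset_finiteJoins hw.1), hw.2⟩

theorem t2Space_phiTopology (hE : IsArchimedean E) (hA : IsAtomic E) :
    @T2Space E (phiTopology E) := by
  have key : ∀ x y : E, ¬ x ≤ y → ∃ w, @IsClopen E (phiTopology E) (Ici w) ∧ w ≤ x ∧ ¬ w ≤ y := by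
    intro x y hxy
    by_contra! h
    exact hxy ((isLUB_atomMultiples hE hA x).2 fun w hw =>
      h w (isClopen_Ici_phiTopology (atomMultiples_subset_finiteJoins hw.1)) hw.2)
  refine @T2Space.mk E (phiTopology E) fun x y hxy => ?_
  by_cases h : x ≤ y
  · obtain ⟨w, hw, hwy, hwx⟩ := key y x fun h' => hxy (le_antisymm h h')
    exact ⟨(Ici w)ᶜ, Ici w, hw.1.isOpen_compl, hw.2, hwx, hwy, disjoint_compl_left⟩
  · obtain ⟨w, hw, hwx, hwy⟩ := key x y h
    exact ⟨Ici w, (Ici w)ᶜ, hw.2, hw.1.isOpen_compl, hwx, hwy, disjoint_compl_right⟩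

end Phi

/-! ### Almost orthogonality -/

section AlmostOrthogonal

variable {E : Type u} [LatticeEffectAlgebra E]

theorem AlmostOrthogonal.intervalTopology_le_phiTopology (hE : IsArchimedean E)
    (hA : IsAtomic E) (hO : AlmostOrthogonal E) : intervalTopology E ≤ phiTopology E := by
  let := intervalTopology E
  have hIic : ∀ b : E, IsClosed (Iic b) := fun b => by
    have := isClosed_Icc_intervalTopology ⊥ b
    rwa [Icc_bot] at this
  have hIci : ∀ b : E, IsClosed (Ici b) := fun b => by
    have := isClosed_Icc_intervalTopology b ⊤
    rwa [Icc_top] at this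
  have hup : ∀ y ∈ atomMultiples E, IsClopen (Ici y) := by
    intro y hy
    obtain ⟨F, hF, hFy⟩ := exists_finite_le_iff_not_le_compl hE hA hO hy
    refine ⟨hIci y, ?_⟩
    have : (Ici y)ᶜ = ⋃ w ∈ F, Iic (compl w) := by
      ext x
      have := hFy (compl x)
      rw [compl_le_compl_iff] at this
      simp only [mem_compl_iff, mem_Ici, this, mem_iUnion, mem_Iic, exists_prop]
      exact exists_congr fun w => and_congr_right fun _ => le_compl_comm
    rw [← isClosed_compl_iff, this]
    exact hF.isClosed_biUnion fun w _ => hIic _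
  have hdown : ∀ y ∈ atomMultiples E, IsClopen (Iic (compl y)) := by
    intro y hy
    obtain ⟨F, hF, hFy⟩ := exists_finite_le_iff_not_le_compl hE hA hO hy
    refine ⟨hIic _, ?_⟩
    have : (Iic (compl y))ᶜ = ⋃ w ∈ F, Ici w := by
      ext x
      simp only [mem_compl_iff, mem_Iic, hFy, mem_iUnion, mem_Ici, exists_prop]
    rw [← isClosed_compl_iff, this]
    exact hF.isClosed_biUnion fun w _ => hIci _
  refine le_phiTopology ?_ ?_
  · rintro x ⟨n, a, y, l, -, hy, hx⟩
    have : Ici x = ⋂ i, Ici (y i) := by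
      ext z
      rw [mem_Ici, isLUB_le_iff hx]
      simp [upperBounds]
    rw [this]
    exact isClopen_iInter_of_finite fun i =>
      hup _ ⟨a i, (hy i).1, l i, (hy i).2.1, (hy i).2.2⟩
  · rintro v ⟨n, a, y, l, -, hy, hx⟩
    have : Iic v = ⋂ i, Iic (compl (y i)) := by
      ext z
      rw [mem_Iic, ← compl_le_compl_iff, isLUB_le_iff hx]
      simp [upperBounds, le_compl_comm]
    rw [this]
    exact isClopen_iInter_of_finite fun i =>
      hdown _ ⟨a i, (hy i).1, l i, (hy i).2.1, (hy i).2.2⟩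

theorem OContinuous.almostOrthogonal (hC : OContinuous E)
    (hT : @T2Space E (intervalTopology E)) : AlmostOrthogonal E := by
  intro a ha
  by_contra hinf
  set B : Set E := {b : E | IsAtom b ∧ ¬ b ≤ compl a}
  have hne : NeBot (cofinite ⊓ 𝓟 B) := cofinite_inf_principal_neBot_iff.2 hinf
  let f : Ultrafilter E := Ultrafilter.of (cofinite ⊓ 𝓟 B)
  have hf : (f : Filter E) ≤ cofinite ⊓ 𝓟 B := Ultrafilter.of_le _
  have hfB : ∀ᶠ b in (f : Filter E), b ∈ B := le_principal_iff.1 (hf.trans inf_le_right)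
  have hG := isGLB_eventually_le hT f (hf.trans inf_le_left) (hfB.mono fun b hb => hb.1)
  let S : Set Eᵒᵈ := {d | ∀ᶠ b in (f : Filter E), b ≤ OrderDual.ofDual d}
  have : Nonempty S := ⟨⟨OrderDual.toDual ⊤, Eventually.of_forall fun b => le_top⟩⟩
  have : IsDirectedOrder S :=
    ⟨fun p q => ⟨⟨p.1 ⊔ q.1, (p.2.and q.2).mono fun b hb => le_inf hb.1 hb.2⟩,
      (le_sup_left : p.1 ≤ p.1 ⊔ q.1), (le_sup_right : q.1 ≤ p.1 ⊔ q.1)⟩⟩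
  have hsup := hC S (fun d => compl (OrderDual.ofDual d.1)) ⊤ a
    (fun d e h => compl_le_compl_iff.2 h) (by
      refine ⟨fun _ _ => le_top, fun z hz => ?_⟩
      rw [← compl_bot, compl_le_comm]
      exact hG.2 fun d hd => compl_le_comm.1 (hz ⟨⟨OrderDual.toDual d, hd⟩, rfl⟩))
  rw [top_inf_eq] at hsup
  refine ha.1 (le_bot_iff.1 (hsup.2 (forall_mem_range.2 fun d => ?_)))
  obtain ⟨b, hbd, hb⟩ := (d.2.and hfB).exists
  refine ((ha.le_iff.1 inf_le_right).resolve_right fun had => hb.2 ?_).le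
  exact hbd.trans (le_compl_comm.1 (inf_eq_right.1 had))

end AlmostOrthogonal

end EffectAlgebra

theorem mainTheorem1 {E : Type u} [LatticeEffectAlgebra E]
    (hArch : EffectAlgebra.IsArchimedean E) (hAtomic : IsAtomic E) :
    List.TFAE
      [EffectAlgebra.intervalTopology E = EffectAlgebra.orderTopology E ∧
          EffectAlgebra.orderTopology E = EffectAlgebra.phiTopology E,
        EffectAlgebra.OContinuous E ∧ @T2Space E (EffectAlgebra.intervalTopology E),
        EffectAlgebra.AlmostOrthogonal E] := by
  have hΦo := EffectAlgebra.phiTopology_le_orderTopology hArch hAtomic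
  have hoi := EffectAlgebra.orderTopology_le_intervalTopology (L := E)
  tfae_have 1 → 2 := by
    rintro ⟨h1, h2⟩
    refine ⟨EffectAlgebra.oContinuous_of_isOpen_Ici fun x => ⟨fun w hw => hw.2, fun z hz => ?_⟩, ?_⟩
    · refine (EffectAlgebra.isLUB_atomMultiples hArch hAtomic x).2 fun w hw => hz ⟨?_, hw.2⟩
      rw [h2]
      exact (EffectAlgebra.isClopen_Ici_phiTopology (EffectAlgebra.atomMultiples_subset_finiteJoins hw.1)).2
    · rw [h1, h2]
      exact EffectAlgebra.t2Space_phiTopology hArch hAtomic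
  tfae_have 2 → 3 := fun h => EffectAlgebra.OContinuous.almostOrthogonal h.1 h.2
  tfae_have 3 → 1 := fun h => by
    have hiΦ := EffectAlgebra.AlmostOrthogonal.intervalTopology_le_phiTopology hArch hAtomic h
    exact ⟨le_antisymm (hiΦ.trans hΦo) hoi, le_antisymm (hoi.trans hiΦ) hΦo⟩
  tfae_finish
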